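/- For $N\in\mathbb N=\{0,1,2,\dots\}$ let $I_N$ be the symmetric inverse monoid, i.e. the inverse monoid of all bijections between subsets of $\{1,\dots,N\}$, with composition of partial maps from left to right and with $f^{-1}$ the inverse partial bijection. For integers $n\ge 0$ and $k\ge 1$ let $[1,2,\dots,n]\cup(n+1,n+2,\dots,n+k)\in I_{n+k}$ be the partial permutation that maps $i\mapsto i+1$ for $1\le i<n$, is undefined at $n$ (if $n\ge 1$), and permutes $n+1,\dots,n+k$ cyclically: $n+1\mapsto n+2\mapsto\cdots\mapsto n+k\mapsto n+1$. (For $n=0$ it is just the cycle; for $n=1$ the chain $[1]$ is the empty map on the point $1$.) Let $$S_{n,k}=\mathrm{Inv}\bigl\langle x \;\big|\; x^nx^{-n}=x^{n+1}x^{-(n+1)},\ x^nx^{-n}=x^nx^{-n}x^k\bigr\rangle,$$ that is, the quotient of the free inverse monoid on one generator $x$ by the least congruence containing the two relations, where $x^{-i}=(x^{-1})^i$. **Theorem.** For all $n\ge 0$ and $k\ge 1$, the inverse submonoid of $I_{n+k}$ generated by $[1,2,\dots,n]\cup(n+1,n+2,\dots,n+k)$ (the submonoid generated by this element and its inverse)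 is isomorphic to $S_{n,k}$. Moreover, for all $n,m\ge 0$ and $k,l\ge 1$, $S_{n,k}\cong S_{m,l}$ if and only if $(n,k)=(m,l)$. -/

import Mathlib

/-- An inverse monoid: a monoid with an involutive anti-automorphism `a ↦ a⁻¹` such that
`a * a⁻¹ * a = a` and the elements `a * a⁻¹` commute with each other. These axioms are equivalent
to requiring that every `a` has exactly one `b` with `a * b * a = a` and `b * a * b = b`
(see `InverseMonoid.existsUnique_inverse`), and then `b = a⁻¹`. -/
class InverseMonoid (M : Type*) extends Monoid M, Inv M where
  inv_involutive : ∀ a : M, (a⁻¹)⁻¹ = a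
  inv_mul_rev : ∀ a b : M, (a * b)⁻¹ = b⁻¹ * a⁻¹
  mul_inv_mul_self : ∀ a : M, a * a⁻¹ * a = a
  mul_inv_comm : ∀ a b : M, a * a⁻¹ * (b * b⁻¹) = b * b⁻¹ * (a * a⁻¹)

namespace InverseMonoid

/-- Two inverses of the same element coincide as soon as the relevant idempotents commute. -/
theorem inverse_unique_of_comm {M : Type*} [Monoid M] {a x y : M}
    (hx₁ : a * x * a = a) (hx₂ : x * a * x = x) (hy₁ : a * y * a = a) (hy₂ : y * a * y = y)
    (h₁ : a * x * (a * y) = a * y * (a * x)) (h₂ : x * a * (y * a) = y * a * (x * a)) :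
    x = y := by
  have e₁ : x = x * a * y := by
    calc x = x * (a * y * a) * x := by rw [hy₁, hx₂]
      _ = x * (a * y * (a * x)) := by simp only [mul_assoc]
      _ = x * (a * x * (a * y)) := by rw [h₁]
      _ = x * a * x * (a * y) := by simp only [mul_assoc]
      _ = x * a * y := by rw [hx₂, mul_assoc]
  have e₂ : y = x * a * y := by
    calc y = y * (a * x * a) * y := by rw [hx₁, hy₂]
      _ = y * a * (x * a) * y := by simp only [mul_assoc]
      _ = x * a * (y * a) * y := by rw [h₂]
      _ = x * a * (y * a * y) := by simp only [mul_assoc]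
      _ = x * a * y := by rw [hy₂]
  rw [e₁, ← e₂]

variable {M : Type*} [InverseMonoid M]

theorem inv_mul_inv_self (a : M) : a⁻¹ * a * a⁻¹ = a⁻¹ := by
  simpa only [inv_involutive] using mul_inv_mul_self a⁻¹

theorem inv_mul_comm (a b : M) : a⁻¹ * a * (b⁻¹ * b) = b⁻¹ * b * (a⁻¹ * a) := by
  simpa only [inv_involutive] using mul_inv_comm a⁻¹ b⁻¹

/-- An idempotent `e` of an inverse monoid satisfies `e = e * e⁻¹`. -/
theorem eq_mul_inv_of_idem {e : M} (h : e * e = e) : e = e * e⁻¹ := by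
  have h' : e⁻¹ * e⁻¹ = e⁻¹ := by rw [← inv_mul_rev, h]
  have key : e = e⁻¹ := by
    calc e = e * (e⁻¹ * e⁻¹) * e := by rw [h', mul_inv_mul_self]
      _ = e * e⁻¹ * (e⁻¹ * (e⁻¹)⁻¹) := by simp only [inv_involutive, mul_assoc]
      _ = e⁻¹ * (e⁻¹)⁻¹ * (e * e⁻¹) := mul_inv_comm _ _
      _ = e⁻¹ * (e * e) * e⁻¹ := by simp only [inv_involutive, mul_assoc]
      _ = e⁻¹ := by rw [h, inv_mul_inv_self]
  rw [← key, h]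

/-- Every element of an inverse monoid has exactly one inverse. -/
theorem existsUnique_inverse (a : M) : ∃! b : M, a * b * a = a ∧ b * a * b = b := by
  refine ⟨a⁻¹, ⟨mul_inv_mul_self a, inv_mul_inv_self a⟩, ?_⟩
  rintro b ⟨h₁, h₂⟩
  have hab : a * b * (a * b) = a * b := by rw [← mul_assoc, h₁]
  have hba : b * a * (b * a) = b * a := by rw [← mul_assoc, h₂]
  refine inverse_unique_of_comm h₁ h₂ (mul_inv_mul_self a) (inv_mul_inv_self a) ?_ ?_
  · rw [eq_mul_inv_of_idem hab]
    exact mul_inv_comm _ _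
  · rw [eq_mul_inv_of_idem hba]
    simpa only [inv_involutive] using mul_inv_comm (b * a) a⁻¹

/-- The inverse submonoid generated by one element `f`: the submonoid generated by `f` and
`f⁻¹`. -/
def closureSingleton (f : M) : Submonoid M := Submonoid.closure {f, f⁻¹}

theorem inv_mem_closureSingleton (f : M) {a : M} (ha : a ∈ closureSingleton f) :
    a⁻¹ ∈ closureSingleton f := by
  have h1 : (1 : M)⁻¹ = 1 := by
    have := mul_inv_mul_self (1 : M)
    rwa [one_mul, mul_one] at this
  unfold closureSingleton at ha ⊢
  induction ha using Submonoid.closure_induction with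
  | mem x hx =>
    rcases hx with rfl | rfl
    · exact Submonoid.subset_closure (Or.inr rfl)
    · rw [inv_involutive]
      exact Submonoid.subset_closure (Or.inl rfl)
  | one => rw [h1]; exact Submonoid.one_mem _
  | mul x y _ _ hx hy => rw [inv_mul_rev]; exact Submonoid.mul_mem _ hy hx

/-- The inverse submonoid generated by `f` is an inverse monoid in its own right. -/
instance (f : M) : InverseMonoid (closureSingleton f) where
  inv a := ⟨(a : M)⁻¹, inv_mem_closureSingleton f a.2⟩
  inv_involutive a := Subtype.ext (inv_involutive (a : M))
  inv_mul_rev a b := Subtype.ext (inv_mul_rev (a : M) b)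
  mul_inv_mul_self a := Subtype.ext (mul_inv_mul_self (a : M))
  mul_inv_comm a b := Subtype.ext (mul_inv_comm (a : M) b)

/-- Every monoid congruence on an inverse monoid respects inversion. -/
theorem con_inv (c : Con M) {a b : M} (h : c a b) : c a⁻¹ b⁻¹ := by
  rw [← Con.eq] at h ⊢
  refine inverse_unique_of_comm (a := (a : c.Quotient)) ?_ ?_ ?_ ?_ ?_ ?_
  · rw [← Con.coe_mul, ← Con.coe_mul, mul_inv_mul_self]
  · rw [← Con.coe_mul, ← Con.coe_mul, inv_mul_inv_self]
  · rw [h, ← Con.coe_mul, ← Con.coe_mul, mul_inv_mul_self]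
  · rw [h, ← Con.coe_mul, ← Con.coe_mul, inv_mul_inv_self]
  · conv_lhs => rw [← Con.coe_mul, h, ← Con.coe_mul, ← Con.coe_mul, mul_inv_comm]
    conv_rhs => rw [← Con.coe_mul, h, ← Con.coe_mul]
    simp only [Con.coe_mul, h]
  · conv_lhs => rw [← Con.coe_mul, h, ← Con.coe_mul, ← Con.coe_mul, inv_mul_comm]
    conv_rhs => rw [← Con.coe_mul, h, ← Con.coe_mul]
    simp only [Con.coe_mul, h]

/-- The quotient of an inverse monoid by a congruence, with the induced inversion. -/
instance (c : Con M) : InverseMonoid c.Quotient where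
  inv := Quotient.map' (fun a => a⁻¹) fun _ _ h => con_inv c h
  inv_involutive := by
    rintro ⟨a⟩
    exact congrArg (fun z : M => (z : c.Quotient)) (inv_involutive a)
  inv_mul_rev := by
    rintro ⟨a⟩ ⟨b⟩
    exact congrArg (fun z : M => (z : c.Quotient)) (inv_mul_rev a b)
  mul_inv_mul_self := by
    rintro ⟨a⟩
    exact congrArg (fun z : M => (z : c.Quotient)) (mul_inv_mul_self a)
  mul_inv_comm := by
    rintro ⟨a⟩ ⟨b⟩
    exact congrArg (fun z : M => (z : c.Quotient)) (mul_inv_comm a b)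

end InverseMonoid

/-- The symmetric inverse monoid `I_n`: all bijections between subsets of an `n`-element set.
The points `1, …, n` are the elements `0, …, n - 1` of `Fin n`. -/
def SymmetricInverseMonoid (n : ℕ) : Type := Fin n ≃. Fin n

theorem partialBijection_regular {α : Type*} (f : α ≃. α) : (f.trans f.symm).trans f = f := by
  classical
  refine PEquiv.ext fun i => Option.ext fun j => ?_
  simp only [PEquiv.trans_eq_some, PEquiv.self_trans_symm, PEquiv.ofSet_eq_some_iff]
  constructor
  · rintro ⟨b, ⟨rfl, -⟩, hb⟩
    exact hb
  · intro h
    exact ⟨i, ⟨rfl, Option.isSome_iff_exists.2 ⟨j, h⟩⟩, h⟩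

theorem partialBijection_comm {α : Type*} (f g : α ≃. α) :
    (f.trans f.symm).trans (g.trans g.symm) = (g.trans g.symm).trans (f.trans f.symm) := by
  classical
  refine PEquiv.ext fun i => Option.ext fun j => ?_
  simp only [PEquiv.trans_eq_some, PEquiv.self_trans_symm, PEquiv.ofSet_eq_some_iff]
  constructor
  · rintro ⟨b, ⟨rfl, h₁⟩, rfl, h₂⟩
    exact ⟨_, ⟨rfl, h₂⟩, rfl, h₁⟩
  · rintro ⟨b, ⟨rfl, h₁⟩, rfl, h₂⟩
    exact ⟨_, ⟨rfl, h₂⟩, rfl, h₁⟩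

/-- The product `f * g` is the composition "first `f`, then `g`", and `f⁻¹` is the inverse
partial bijection. -/
instance (n : ℕ) : InverseMonoid (SymmetricInverseMonoid n) where
  mul f g := PEquiv.trans f g
  one := PEquiv.refl (Fin n)
  inv f := PEquiv.symm f
  mul_assoc f g h := PEquiv.trans_assoc f g h
  one_mul f := PEquiv.refl_trans f
  mul_one f := PEquiv.trans_refl f
  inv_involutive f := PEquiv.symm_symm f
  inv_mul_rev f g := PEquiv.symm_trans_rev f g
  mul_inv_mul_self f := partialBijection_regular f
  mul_inv_comm f g := partialBijection_comm f g

/-- The partial permutation `[1, 2, …, n] ∪ (n+1, n+2, …, n+k)` in `I_{n+k}`: the chain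
`1 ↦ 2 ↦ ⋯ ↦ n` with `n` outside the domain, together with the cycle
`n+1 ↦ n+2 ↦ ⋯ ↦ n+k ↦ n+1`. In the numbering by `Fin (n + k)` the chain runs through
`0, …, n - 1` and the cycle through `n, …, n + k - 1`. -/
def chainCycle (n k : ℕ) : SymmetricInverseMonoid (n + k) where
  toFun i :=
    if i.val + 1 = n then none
    else if h : i.val + 1 < n + k then some ⟨i.val + 1, h⟩
    else if h : n < n + k then some ⟨n, h⟩
    else none
  invFun j :=
    if h : j.val = n then some ⟨n + k - 1, by have := j.isLt; omega⟩
    else if j.val = 0 then none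
    else some ⟨j.val - 1, by have := j.isLt; omega⟩
  inv i j := by
    rcases i with ⟨i, hi⟩
    rcases j with ⟨j, hj⟩
    dsimp only
    split_ifs <;> simp <;> omega

/-- The formal inverse of a word over `X ∪ X⁻¹`: reverse the word and invert every letter.
The letter `(x, true)` stands for `x` and `(x, false)` for `x⁻¹`. -/
def formalInv {X : Type*} (w : FreeMonoid (X × Bool)) : FreeMonoid (X × Bool) :=
  FreeMonoid.ofList ((w.toList.map fun p => (p.1, !p.2)).reverse)

theorem formalInv_formalInv {X : Type*} (w : FreeMonoid (X × Bool)) :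
    formalInv (formalInv w) = w := by
  simp [formalInv, List.map_reverse, Function.comp_def]

theorem formalInv_mul {X : Type*} (u v : FreeMonoid (X × Bool)) :
    formalInv (u * v) = formalInv v * formalInv u := by
  simp [formalInv, FreeMonoid.toList_mul]

/-- The pairs generating the Vagner congruence on the free monoid over `X ∪ X⁻¹`. -/
inductive VagnerRel (X : Type*) : FreeMonoid (X × Bool) → FreeMonoid (X × Bool) → Prop
  | regular (u : FreeMonoid (X × Bool)) : VagnerRel X (u * formalInv u * u) u
  | comm (u v : FreeMonoid (X × Bool)) :
      VagnerRel X (u * formalInv u * (v * formalInv v)) (v * formalInv v * (u * formalInv u))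

theorem vagner_formalInv {X : Type*} {u v : FreeMonoid (X × Bool)}
    (h : conGen (VagnerRel X) u v) : conGen (VagnerRel X) (formalInv u) (formalInv v) := by
  change ConGen.Rel (VagnerRel X) u v at h
  induction h with
  | of u v h =>
    cases h with
    | regular u =>
      have := VagnerRel.regular (formalInv v)
      rw [formalInv_formalInv] at this
      rw [formalInv_mul, formalInv_mul, formalInv_formalInv, ← mul_assoc]
      exact ConGen.Rel.of _ _ this
    | comm u v =>
      simp only [formalInv_mul, formalInv_formalInv]
      exact ConGen.Rel.of _ _ (VagnerRel.comm v u)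
  | refl u => exact ConGen.Rel.refl _
  | symm _ ih => exact ConGen.Rel.symm ih
  | trans _ _ ih₁ ih₂ => exact ConGen.Rel.trans ih₁ ih₂
  | mul _ _ ih₁ ih₂ =>
    rw [formalInv_mul, formalInv_mul]
    exact ConGen.Rel.mul ih₂ ih₁

/-- The free inverse monoid on `X`: the quotient of the free monoid over `X ∪ X⁻¹` by the Vagner
congruence. -/
def FreeInverseMonoid (X : Type*) : Type _ := (conGen (VagnerRel X)).Quotient

namespace FreeInverseMonoid

variable {X : Type*}

instance : Monoid (FreeInverseMonoid X) :=
  inferInstanceAs (Monoid (conGen (VagnerRel X)).Quotient)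

instance : InverseMonoid (FreeInverseMonoid X) where
  inv := Quotient.map' formalInv fun _ _ h => vagner_formalInv h
  inv_involutive := by
    rintro ⟨u⟩
    exact congrArg (fun z : FreeMonoid (X × Bool) => (z : (conGen (VagnerRel X)).Quotient))
       (formalInv_formalInv u)
  inv_mul_rev := by
    rintro ⟨u⟩ ⟨v⟩
    exact congrArg (fun z : FreeMonoid (X × Bool) => (z : (conGen (VagnerRel X)).Quotient))
       (formalInv_mul u v)
  mul_inv_mul_self := by
    rintro ⟨u⟩
    exact (Con.eq _).2 (ConGen.Rel.of _ _ (VagnerRel.regular u))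
  mul_inv_comm := by
    rintro ⟨u⟩ ⟨v⟩
    exact (Con.eq _).2 (ConGen.Rel.of _ _ (VagnerRel.comm u v))

/-- The generator of the free inverse monoid belonging to a letter. -/
def of (x : X) : FreeInverseMonoid X :=
  ((FreeMonoid.of (x, true) : FreeMonoid (X × Bool)) : (conGen (VagnerRel X)).Quotient)

end FreeInverseMonoid

/-- The inverse monoid `Inv⟨X | r⟩`: the quotient of the free inverse monoid on `X` by the least
congruence containing `r`. -/
abbrev InvPresentation (X : Type*) (r : FreeInverseMonoid X → FreeInverseMonoid X → Prop) :
    Type _ :=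
  (conGen r).Quotient

/-- The defining relations `xⁿx⁻ⁿ = xⁿ⁺¹x⁻⁽ⁿ⁺¹⁾` and `xⁿx⁻ⁿ = xⁿx⁻ⁿxᵏ` over one generator `x`,
where `x⁻ⁱ` means `(x⁻¹)ⁱ`. -/
inductive MonogenicRel (n k : ℕ) : FreeInverseMonoid Unit → FreeInverseMonoid Unit → Prop
  | chain : MonogenicRel n k
      (FreeInverseMonoid.of () ^ n * (FreeInverseMonoid.of ())⁻¹ ^ n)
      (FreeInverseMonoid.of () ^ (n + 1) * (FreeInverseMonoid.of ())⁻¹ ^ (n + 1))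
  | cycle : MonogenicRel n k
      (FreeInverseMonoid.of () ^ n * (FreeInverseMonoid.of ())⁻¹ ^ n)
      (FreeInverseMonoid.of () ^ n * (FreeInverseMonoid.of ())⁻¹ ^ n *
        FreeInverseMonoid.of () ^ k)

/-- The monoid `S_{n,k} = Inv⟨x | xⁿx⁻ⁿ = xⁿ⁺¹x⁻⁽ⁿ⁺¹⁾, xⁿx⁻ⁿ = xⁿx⁻ⁿxᵏ⟩`. -/
abbrev MonogenicInverseMonoid (n k : ℕ) : Type := InvPresentation Unit (MonogenicRel n k)

/-! Commuting idempotents bring every element of a monogenic inverse monoid to the form `x⁻ⁱ xʲ x⁻ˡ`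
with `i, l ≤ j` (`exists_normalForm`). In `S_{n,k}` the idempotent `e = xⁿx⁻ⁿ` commutes with `x` and
`x⁻¹`, and `e x⁻¹ = e xᵏ⁻¹`, so all forms with `j ≥ n` become `e xʳ`, where only `r` mod `k` matters
(`exists_reduced_normalForm`). The chain-cycle satisfies the relations, so `S_{n,k}` maps onto the
inverse monoid it generates. The map is injective: forms with `j < n` are told apart by their action
on the chain, the elements `e xʳ` by theirs on the cycle, and `e xʳ` is undefined on the chain.

For the classification, an isomorphism need not preserve generators, so a law valid for all elements
is used: `S_{m,l}` satisfies `aᵐ⁺ˡ = aᵐ`, whereas the generator of `S_{n,k}` satisfies this only if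
`n ≤ m` and `k ∣ l`. By symmetry an isomorphism forces equal parameters. -/

namespace InverseMonoid

/-! ### Normal forms in monogenic inverse monoids -/

section NormalForm

variable {M : Type*} [InverseMonoid M]

theorem inv_one' : (1 : M)⁻¹ = 1 := by
  have := mul_inv_mul_self (1 : M)
  rwa [one_mul, mul_one] at this

theorem inv_pow' (x : M) (n : ℕ) : (x ^ n)⁻¹ = x⁻¹ ^ n := by
  induction n with
  | zero => simp only [pow_zero, inv_one']
  | succ n ih => rw [pow_succ, inv_mul_rev, ih, pow_succ']

theorem pow_mul_inv_pow_mul_pow (x : M) (n : ℕ) : x ^ n * x⁻¹ ^ n * x ^ n = x ^ n := by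
  rw [← inv_pow', mul_inv_mul_self]

theorem pow_mul_inv_pow_inv (x : M) (n : ℕ) : (x ^ n * x⁻¹ ^ n)⁻¹ = x ^ n * x⁻¹ ^ n := by
  rw [inv_mul_rev, inv_pow', inv_pow', inv_involutive]

theorem pow_mul_inv_pow_comm_inv_mul (x : M) (j : ℕ) :
    x ^ j * x⁻¹ ^ j * (x⁻¹ * x) = x⁻¹ * x * (x ^ j * x⁻¹ ^ j) := by
  have := mul_inv_comm (x ^ j) x⁻¹
  rwa [inv_pow', inv_involutive] at this

/-- The idempotents `xʲx⁻ʲ` and `x⁻¹x` commute. This handles an `x⁻¹` appended to a normal form with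
`l = j`. -/
theorem pow_mul_inv_pow_mul_inv (x : M) (j : ℕ) :
    x ^ j * x⁻¹ ^ (j + 1) = x⁻¹ * x ^ (j + 1) * x⁻¹ ^ (j + 1) := by
  calc x ^ j * x⁻¹ ^ (j + 1) = x ^ j * x⁻¹ ^ j * (x⁻¹ * x * x⁻¹) := by
        rw [inv_mul_inv_self, mul_assoc, pow_succ]
    _ = x ^ j * x⁻¹ ^ j * (x⁻¹ * x) * x⁻¹ := by simp only [mul_assoc]
    _ = x⁻¹ * x ^ (j + 1) * x⁻¹ ^ (j + 1) := by
        rw [pow_mul_inv_pow_comm_inv_mul, pow_succ' x, pow_succ x⁻¹]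
        simp only [mul_assoc]

theorem pow_mul_inv_pow_succ_mul (x : M) {j l : ℕ} (h : l + 1 ≤ j) :
    x ^ j * x⁻¹ ^ (l + 1) * x = x ^ j * x⁻¹ ^ l := by
  obtain ⟨d, rfl⟩ := Nat.exists_eq_add_of_le' h
  have key : x ^ (l + 1) * x⁻¹ ^ (l + 1) * x = x ^ (l + 1) * x⁻¹ ^ l := by
    calc x ^ (l + 1) * x⁻¹ ^ (l + 1) * x = x * (x ^ l * x⁻¹ ^ l * (x⁻¹ * x)) := by
          rw [pow_succ' x, pow_succ x⁻¹]; simp only [mul_assoc]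
      _ = x * x⁻¹ * x * (x ^ l * x⁻¹ ^ l) := by
          rw [pow_mul_inv_pow_comm_inv_mul]; simp only [mul_assoc]
      _ = x ^ (l + 1) * x⁻¹ ^ l := by
          rw [mul_inv_mul_self, pow_succ', mul_assoc]
  calc x ^ (d + (l + 1)) * x⁻¹ ^ (l + 1) * x
      = x ^ d * (x ^ (l + 1) * x⁻¹ ^ (l + 1) * x) := by
        rw [pow_add]; simp only [mul_assoc]
    _ = _ := by rw [key, pow_add x d (l + 1), mul_assoc]

/-- Every element of a monogenic inverse monoid has the form `x⁻ⁱ xʲ x⁻ˡ` with `i, l ≤ j`. -/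
theorem exists_normalForm (x : M) {a : M} (ha : a ∈ closureSingleton x) :
    ∃ i j l : ℕ, i ≤ j ∧ l ≤ j ∧ a = x⁻¹ ^ i * x ^ j * x⁻¹ ^ l := by
  unfold closureSingleton at ha
  induction ha using Submonoid.closure_induction_right with
  | one => exact ⟨0, 0, 0, le_rfl, le_rfl, by simp⟩
  | mul_right a ha y hy ih =>
    obtain ⟨i, j, l, hi, hl, rfl⟩ := ih
    rcases hy with rfl | rfl
    · cases l with
      | zero =>
        exact ⟨i, j + 1, 0, by omega, by omega, by simp [pow_succ, mul_assoc]⟩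
      | succ l =>
        refine ⟨i, j, l, hi, by omega, ?_⟩
        rw [mul_assoc, mul_assoc, ← mul_assoc (y ^ j), pow_mul_inv_pow_succ_mul y hl, mul_assoc]
    · rcases hl.lt_or_eq with h | rfl
      · exact ⟨i, j, l + 1, hi, h, by simp [pow_succ, mul_assoc]⟩
      -- One more `x⁻¹` would push `l` beyond `j`; the excess is traded for an extra `x⁻¹` on the
      -- left.
      · refine ⟨i + 1, l + 1, l + 1, by omega, le_rfl, ?_⟩
        rw [mul_assoc, ← pow_succ, mul_assoc, pow_mul_inv_pow_mul_inv, pow_succ x⁻¹ i]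
        simp only [mul_assoc]

/-! ### Collapse under the defining relations -/

variable {x : M} {n k : ℕ}

/-- With `e` rewritten as `xⁿ⁺¹x⁻⁽ⁿ⁺¹⁾`, a trailing `x` cancels one `x⁻¹` and leaves `xⁿ⁺¹x⁻ⁿ = x
e`. -/
theorem pow_mul_inv_pow_mul_comm
    (h₁ : x ^ n * x⁻¹ ^ n = x ^ (n + 1) * x⁻¹ ^ (n + 1)) :
    Commute (x ^ n * x⁻¹ ^ n) x := by
  change _ * x = x * _
  conv_lhs => rw [h₁, pow_mul_inv_pow_succ_mul x le_rfl]
  rw [pow_succ', mul_assoc]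

theorem pow_mul_inv_pow_mul_inv_comm
    (h₁ : x ^ n * x⁻¹ ^ n = x ^ (n + 1) * x⁻¹ ^ (n + 1)) :
    Commute (x ^ n * x⁻¹ ^ n) x⁻¹ := by
  have h := congrArg (fun z : M => z⁻¹) (pow_mul_inv_pow_mul_comm h₁).eq
  simp only [inv_mul_rev x, inv_mul_rev _ x, pow_mul_inv_pow_inv] at h
  exact h.symm

/-- Since `e` lies below `x x⁻¹`, the last `x` of `e xᵏ` cancels against `x⁻¹`. Thus negative powers
can be eliminated next to `e`. -/
theorem pow_mul_inv_pow_mul_inv_eq (hk : 1 ≤ k)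
    (h₁ : x ^ n * x⁻¹ ^ n = x ^ (n + 1) * x⁻¹ ^ (n + 1))
    (h₂ : x ^ n * x⁻¹ ^ n = x ^ n * x⁻¹ ^ n * x ^ k) :
    x ^ n * x⁻¹ ^ n * x⁻¹ = x ^ n * x⁻¹ ^ n * x ^ (k - 1) := by
  have hc := pow_mul_inv_pow_mul_comm h₁
  have hx : x ^ n * x⁻¹ ^ n * (x * x⁻¹) = x ^ n * x⁻¹ ^ n := by
    rw [← mul_assoc, hc.eq]
    conv_rhs => rw [h₁]
    rw [pow_succ', pow_succ]
    simp only [mul_assoc]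
  obtain ⟨k, rfl⟩ := Nat.exists_eq_add_of_le' hk
  conv_lhs => rw [h₂]
  rw [pow_succ, ← mul_assoc, (hc.pow_right k).eq, mul_assoc, mul_assoc, hx, Nat.add_sub_cancel,
    (hc.pow_right k).eq]

theorem exists_pow_mul_inv_pow_mul_inv_pow (hk : 1 ≤ k)
    (h₁ : x ^ n * x⁻¹ ^ n = x ^ (n + 1) * x⁻¹ ^ (n + 1))
    (h₂ : x ^ n * x⁻¹ ^ n = x ^ n * x⁻¹ ^ n * x ^ k) (i : ℕ) :
    ∃ r, x ^ n * x⁻¹ ^ n * x⁻¹ ^ i = x ^ n * x⁻¹ ^ n * x ^ r := by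
  induction i with
  | zero => exact ⟨0, by simp⟩
  | succ i ih =>
    obtain ⟨r, hr⟩ := ih
    have hc := pow_mul_inv_pow_mul_comm h₁
    refine ⟨r + (k - 1), ?_⟩
    rw [pow_succ x⁻¹ i, ← mul_assoc, hr, (hc.pow_right r).eq, mul_assoc,
      pow_mul_inv_pow_mul_inv_eq hk h₁ h₂, ← mul_assoc, ← (hc.pow_right r).eq, mul_assoc,
      ← pow_add]

theorem pow_mul_inv_pow_mul_pow_congr (h₂ : x ^ n * x⁻¹ ^ n = x ^ n * x⁻¹ ^ n * x ^ k)
    {r s : ℕ} (h : r ≡ s [MOD k]) :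
    x ^ n * x⁻¹ ^ n * x ^ r = x ^ n * x⁻¹ ^ n * x ^ s := by
  have hq : ∀ q, x ^ n * x⁻¹ ^ n * x ^ (k * q) = x ^ n * x⁻¹ ^ n := by
    intro q
    induction q with
    | zero => simp
    | succ q ih => rw [Nat.mul_succ, pow_add, ← mul_assoc, ih, ← h₂]
  have hmod : ∀ r, x ^ n * x⁻¹ ^ n * x ^ r = x ^ n * x⁻¹ ^ n * x ^ (r % k) := by
    intro r
    conv_lhs => rw [← Nat.div_add_mod r k, pow_add, ← mul_assoc, hq]
  rw [hmod r, hmod s, h]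

/-- Under the relations of `S_{n,k}`, the normal forms with `n ≤ j` collapse to `xⁿx⁻ⁿxʳ`. -/
theorem exists_reduced_normalForm (hk : 1 ≤ k)
    (h₁ : x ^ n * x⁻¹ ^ n = x ^ (n + 1) * x⁻¹ ^ (n + 1))
    (h₂ : x ^ n * x⁻¹ ^ n = x ^ n * x⁻¹ ^ n * x ^ k) {a : M} (ha : a ∈ closureSingleton x) :
    (∃ i j l : ℕ, i ≤ j ∧ l ≤ j ∧ j < n ∧ a = x⁻¹ ^ i * x ^ j * x⁻¹ ^ l) ∨
      ∃ r, a = x ^ n * x⁻¹ ^ n * x ^ r := by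
  obtain ⟨i, j, l, hi, hl, rfl⟩ := exists_normalForm x ha
  rcases lt_or_ge j n with hj | hj
  · exact Or.inl ⟨i, j, l, hi, hl, hj, rfl⟩
  right
  have hc := pow_mul_inv_pow_mul_comm h₁
  have hc' := pow_mul_inv_pow_mul_inv_comm h₁
  obtain ⟨r, hr⟩ := exists_pow_mul_inv_pow_mul_inv_pow hk h₁ h₂ i
  obtain ⟨s, hs⟩ := exists_pow_mul_inv_pow_mul_inv_pow hk h₁ h₂ l
  -- For `j ≥ n` the power `xʲ` absorbs `e` on the left; `e` then travels to either side and makes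
  -- the outer powers positive.
  have hej : x ^ j = x ^ n * x⁻¹ ^ n * x ^ j := by
    obtain ⟨d, rfl⟩ := Nat.exists_eq_add_of_le hj
    rw [pow_add, ← mul_assoc, pow_mul_inv_pow_mul_pow]
  refine ⟨r + j + s, ?_⟩
  rw [hej, ← mul_assoc, ← (hc'.pow_right i).eq, hr, mul_assoc _ (x ^ r), ← pow_add,
    (hc.pow_right (r + j)).eq, mul_assoc, hs, ← mul_assoc, ← (hc.pow_right (r + j)).eq, mul_assoc,
    ← pow_add]

end NormalForm

end InverseMonoid

/-! ### Universal properties -/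

namespace FreeInverseMonoid

variable {X M : Type*} [InverseMonoid M]

/-- This turns the images of the Vagner pairs into instances of the inverse monoid axioms. -/
theorem lift_formalInv (f : X → M) (w : FreeMonoid (X × Bool)) :
    FreeMonoid.lift (fun p : X × Bool => if p.2 then f p.1 else (f p.1)⁻¹) (formalInv w) =
      (FreeMonoid.lift (fun p : X × Bool => if p.2 then f p.1 else (f p.1)⁻¹) w)⁻¹ := by
  induction w using FreeMonoid.inductionOn' with
  | one => exact InverseMonoid.inv_one'.symm
  | of_mul p w ih =>
    rw [formalInv_mul, map_mul, map_mul, InverseMonoid.inv_mul_rev, ih]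
    congr 1
    change FreeMonoid.lift _ (FreeMonoid.of (p.1, !p.2)) = _
    rw [FreeMonoid.lift_eval_of, FreeMonoid.lift_eval_of]
    rcases p with ⟨y, _ | _⟩
    · simp [InverseMonoid.inv_involutive]
    · simp

/-- The universal property of the free inverse monoid. -/
def lift (f : X → M) : FreeInverseMonoid X →* M :=
  Con.lift _ (FreeMonoid.lift fun p : X × Bool => if p.2 then f p.1 else (f p.1)⁻¹) <| by
    refine Con.conGen_le.2 fun u v h => ?_
    rw [Con.ker_rel]
    cases h with
    | regular u =>
      simp only [map_mul, lift_formalInv, InverseMonoid.mul_inv_mul_self]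
    | comm u v =>
      simp only [map_mul, lift_formalInv]
      exact InverseMonoid.mul_inv_comm _ _

theorem lift_of (f : X → M) (y : X) : lift f (of y) = f y := by
  change FreeMonoid.lift (fun p : X × Bool => if p.2 then f p.1 else (f p.1)⁻¹)
    (FreeMonoid.of (y, true)) = _
  simp

theorem lift_of_inv (f : X → M) (y : X) : lift f (of y)⁻¹ = (f y)⁻¹ := by
  change FreeMonoid.lift (fun p : X × Bool => if p.2 then f p.1 else (f p.1)⁻¹)
    (FreeMonoid.of (y, false)) = _
  simp

theorem closureSingleton_of : InverseMonoid.closureSingleton (of ()) = ⊤ := by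
  rw [eq_top_iff]
  rintro ⟨w⟩ -
  change ((w : (conGen (VagnerRel Unit)).Quotient) : FreeInverseMonoid Unit) ∈ _
  induction w using FreeMonoid.inductionOn' with
  | one => exact Submonoid.one_mem _
  | of_mul p w ih =>
    have hp : ((FreeMonoid.of p : (conGen (VagnerRel Unit)).Quotient) : FreeInverseMonoid Unit) ∈
        InverseMonoid.closureSingleton (of ()) := by
      refine Submonoid.subset_closure ?_
      rcases p with ⟨⟨⟩, _ | _⟩
      · exact Or.inr rfl
      · exact Or.inl rfl
    exact Submonoid.mul_mem _ hp ih

end FreeInverseMonoid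

namespace MonogenicInverseMonoid

open InverseMonoid

variable {n k : ℕ}

/-- The generator of `S_{n,k}`. -/
def gen (n k : ℕ) : MonogenicInverseMonoid n k :=
  ((FreeInverseMonoid.of () : FreeInverseMonoid Unit) : (conGen (MonogenicRel n k)).Quotient)

theorem gen_chain :
    gen n k ^ n * (gen n k)⁻¹ ^ n = gen n k ^ (n + 1) * (gen n k)⁻¹ ^ (n + 1) := by
  have h : conGen (MonogenicRel n k) _ _ := ConGen.Rel.of _ _ MonogenicRel.chain
  exact (Con.eq _).2 h

theorem gen_cycle :
    gen n k ^ n * (gen n k)⁻¹ ^ n = gen n k ^ n * (gen n k)⁻¹ ^ n * gen n k ^ k := by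
  have h : conGen (MonogenicRel n k) _ _ := ConGen.Rel.of _ _ MonogenicRel.cycle
  exact (Con.eq _).2 h

theorem closureSingleton_gen : closureSingleton (gen n k) = ⊤ := by
  have h := congrArg (Submonoid.map (conGen (MonogenicRel n k)).mk')
    FreeInverseMonoid.closureSingleton_of
  rw [closureSingleton, MonoidHom.map_mclosure, ← MonoidHom.mrange_eq_map,
    MonoidHom.mrange_eq_top.2 Con.mk'_surjective, Set.image_pair] at h
  exact h

variable {M : Type*} [InverseMonoid M]

/-- The universal property of `S_{n,k}`. -/
def lift (x : M) (h₁ : x ^ n * x⁻¹ ^ n = x ^ (n + 1) * x⁻¹ ^ (n + 1))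
    (h₂ : x ^ n * x⁻¹ ^ n = x ^ n * x⁻¹ ^ n * x ^ k) : MonogenicInverseMonoid n k →* M :=
  Con.lift _ (FreeInverseMonoid.lift fun _ => x) <| by
    refine Con.conGen_le.2 fun u v h => ?_
    rw [Con.ker_rel]
    cases h with
    | chain =>
      simpa only [map_mul, map_pow, FreeInverseMonoid.lift_of, FreeInverseMonoid.lift_of_inv]
        using h₁
    | cycle =>
      simpa only [map_mul, map_pow, FreeInverseMonoid.lift_of, FreeInverseMonoid.lift_of_inv]
        using h₂

variable {x : M} {h₁ : x ^ n * x⁻¹ ^ n = x ^ (n + 1) * x⁻¹ ^ (n + 1)}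
  {h₂ : x ^ n * x⁻¹ ^ n = x ^ n * x⁻¹ ^ n * x ^ k}

theorem lift_gen : lift x h₁ h₂ (gen n k) = x :=
  FreeInverseMonoid.lift_of (fun _ : Unit => x) ()

theorem lift_gen_inv : lift x h₁ h₂ (gen n k)⁻¹ = x⁻¹ :=
  FreeInverseMonoid.lift_of_inv (fun _ : Unit => x) ()

theorem mrange_lift : MonoidHom.mrange (lift x h₁ h₂) = closureSingleton x := by
  rw [MonoidHom.mrange_eq_map, ← closureSingleton_gen, closureSingleton, MonoidHom.map_mclosure,
    Set.image_pair, lift_gen, lift_gen_inv, closureSingleton]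

end MonogenicInverseMonoid

/-! ### Partial bijections as relations -/

namespace SymmetricInverseMonoid

variable {N : ℕ}

/-- `f.Maps p q` says that `f` is defined at `p` with value `q`. -/
def Maps (f : SymmetricInverseMonoid N) (p q : Fin N) : Prop :=
  q ∈ (show Fin N ≃. Fin N from f) p

theorem ext_maps {f g : SymmetricInverseMonoid N} (h : ∀ p q, f.Maps p q ↔ g.Maps p q) :
    f = g :=
  PEquiv.ext fun p => Option.ext fun q => h p q

theorem maps_one {p q : Fin N} : (1 : SymmetricInverseMonoid N).Maps p q ↔ p = q := by
  change some p = some q ↔ _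
  simp

theorem maps_mul {f g : SymmetricInverseMonoid N} {p q : Fin N} :
    (f * g).Maps p q ↔ ∃ r, f.Maps p r ∧ g.Maps r q :=
  PEquiv.mem_trans _ _ _ _

theorem maps_inv {f : SymmetricInverseMonoid N} {p q : Fin N} :
    f⁻¹.Maps p q ↔ f.Maps q p :=
  PEquiv.mem_iff_mem _

theorem maps_inv_pow {f : SymmetricInverseMonoid N} {m : ℕ} {p q : Fin N} :
    (f⁻¹ ^ m).Maps p q ↔ (f ^ m).Maps q p := by
  rw [← InverseMonoid.inv_pow', maps_inv]

end SymmetricInverseMonoid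

/-! ### Powers of the chain-cycle -/

section ChainCycle

open SymmetricInverseMonoid InverseMonoid

variable {n k : ℕ}

/-- The positions of the cycle contain each residue mod `k` at most once, so its points can be
compared by congruence. -/
theorem Nat.ModEq.eq_of_mem_window {a b : ℕ} (h : a ≡ b [MOD k]) (ha : n ≤ a) (ha' : a < n + k)
    (hb : n ≤ b) (hb' : b < n + k) : a = b := by
  obtain ⟨u, rfl⟩ := Nat.exists_eq_add_of_le ha
  obtain ⟨v, rfl⟩ := Nat.exists_eq_add_of_le hb
  have := (Nat.ModEq.add_left_cancel' n h).eq_of_lt_of_lt (by omega) (by omega)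
  omega

theorem exists_fin_modEq (hk : 1 ≤ k) {a : ℕ} (ha : n ≤ a) :
    ∃ r : Fin (n + k), n ≤ r.val ∧ a ≡ r.val [MOD k] := by
  obtain ⟨u, rfl⟩ := Nat.exists_eq_add_of_le ha
  refine ⟨⟨n + u % k, by have := Nat.mod_lt u hk; omega⟩, by simp, ?_⟩
  exact Nat.ModEq.add_left n (Nat.mod_modEq u k).symm

theorem maps_chainCycle {p q : Fin (n + k)} :
    (chainCycle n k).Maps p q ↔ q.val < n ∧ q.val = p.val + 1 ∨
      n ≤ p.val ∧ n ≤ q.val ∧ p.val + 1 ≡ q.val [MOD k] := by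
  have hp := p.isLt
  have hq := q.isLt
  have hmod : n ≤ p.val → n ≤ q.val → (p.val + 1 ≡ q.val [MOD k] ↔
      q.val = p.val + 1 ∨ p.val + 1 = n + k ∧ q.val = n) := by
    intro h1 h2
    constructor
    · intro h
      rcases Nat.lt_or_ge (p.val + 1) (n + k) with h3 | h3
      · exact Or.inl (h.eq_of_mem_window (by omega) h3 h2 hq).symm
      · have h4 : p.val + 1 = n + k := by omega
        rw [h4] at h
        have h5 : n ≡ q.val [MOD k] := by
          refine Nat.ModEq.trans ?_ h
          simp [Nat.ModEq]
        exact Or.inr ⟨h4, (h5.eq_of_mem_window le_rfl (by omega) h2 hq).symm⟩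
    · rintro (h | ⟨h, h'⟩)
      · rw [h]
      · rw [h, h']
        simp [Nat.ModEq]
  change (if p.val + 1 = n then none
    else if h : p.val + 1 < n + k then some ⟨p.val + 1, h⟩
    else if h : n < n + k then some ⟨n, h⟩
    else none) = some q ↔ _
  by_cases hnp : n ≤ p.val ∧ n ≤ q.val
  · rw [hmod hnp.1 hnp.2]
    split_ifs <;> simp [Fin.ext_iff] <;> omega
  · split_ifs <;> simp [Fin.ext_iff] <;> omega

theorem maps_chainCycle_pow (hk : 1 ≤ k) {m : ℕ} {p q : Fin (n + k)} :
    (chainCycle n k ^ m).Maps p q ↔ q.val < n ∧ q.val = p.val + m ∨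
      n ≤ p.val ∧ n ≤ q.val ∧ p.val + m ≡ q.val [MOD k] := by
  induction m generalizing q with
  | zero =>
    rw [pow_zero, maps_one, Fin.ext_iff, Nat.add_zero]
    constructor
    · intro h
      rcases Nat.lt_or_ge q.val n with h' | h'
      · exact Or.inl ⟨h', h.symm⟩
      · exact Or.inr ⟨by omega, h', by rw [h]⟩
    · rintro (⟨-, h⟩ | ⟨h1, h2, h⟩)
      · exact h.symm
      · exact h.eq_of_mem_window h1 p.isLt h2 q.isLt
  | succ m ih =>
    rw [pow_succ, maps_mul]
    simp only [ih, maps_chainCycle]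
    constructor
    · rintro ⟨r, ⟨h1, h2⟩ | ⟨h1, h2, h3⟩, ⟨h4, h5⟩ | ⟨h4, h5, h6⟩⟩
      · left; omega
      · omega
      · omega
      · exact Or.inr ⟨h1, h5, (h3.add_right 1).trans h6⟩
    · rintro (⟨h1, h2⟩ | ⟨h1, h2, h3⟩)
      · exact ⟨⟨p.val + m, by omega⟩, Or.inl ⟨by dsimp only; omega, rfl⟩,
          Or.inl ⟨h1, by dsimp only; omega⟩⟩
      · obtain ⟨r, hr, hr'⟩ := exists_fin_modEq hk (show n ≤ p.val + m by omega)
        exact ⟨r, Or.inr ⟨h1, hr, hr'⟩, Or.inr ⟨hr, h2, (hr'.symm.add_right 1).trans h3⟩⟩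

/-- At least `n` steps leave the chain from any of its points, while the cycle is permuted. The
result does not depend on `m`, which is the first defining relation. -/
theorem maps_chainCycle_pow_mul_inv_pow (hk : 1 ≤ k) {m : ℕ} (hm : n ≤ m) {p q : Fin (n + k)} :
    (chainCycle n k ^ m * (chainCycle n k)⁻¹ ^ m).Maps p q ↔ p = q ∧ n ≤ p.val := by
  simp only [maps_mul, maps_inv_pow, maps_chainCycle_pow hk]
  constructor
  · rintro ⟨r, ⟨h1, h2⟩ | ⟨h1, h2, h3⟩, ⟨h4, h5⟩ | ⟨h4, h5, h6⟩⟩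
    · omega
    · omega
    · omega
    · refine ⟨Fin.ext ?_, h1⟩
      exact (Nat.ModEq.add_right_cancel' m (h3.trans h6.symm)).eq_of_mem_window h1 p.isLt h4 q.isLt
  · rintro ⟨rfl, h⟩
    obtain ⟨r, hr, hr'⟩ := exists_fin_modEq hk (show n ≤ p.val + m by omega)
    exact ⟨r, Or.inr ⟨h, hr, hr'⟩, Or.inr ⟨h, hr, hr'⟩⟩

theorem maps_idempotent_mul_chainCycle_pow (hk : 1 ≤ k) {r : ℕ} {p q : Fin (n + k)} :
    (chainCycle n k ^ n * (chainCycle n k)⁻¹ ^ n * chainCycle n k ^ r).Maps p q ↔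
      n ≤ p.val ∧ n ≤ q.val ∧ p.val + r ≡ q.val [MOD k] := by
  rw [maps_mul]
  simp only [maps_chainCycle_pow_mul_inv_pow hk le_rfl, maps_chainCycle_pow hk]
  constructor
  · rintro ⟨_, ⟨rfl, h⟩, h' | h'⟩
    · omega
    · exact h'
  · intro h
    exact ⟨p, ⟨rfl, h.1⟩, Or.inr h⟩

theorem chainCycle_chain (hk : 1 ≤ k) :
    chainCycle n k ^ n * (chainCycle n k)⁻¹ ^ n =
      chainCycle n k ^ (n + 1) * (chainCycle n k)⁻¹ ^ (n + 1) :=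
  ext_maps fun p q => by
    rw [maps_chainCycle_pow_mul_inv_pow hk le_rfl, maps_chainCycle_pow_mul_inv_pow hk n.le_succ]

theorem chainCycle_cycle (hk : 1 ≤ k) :
    chainCycle n k ^ n * (chainCycle n k)⁻¹ ^ n =
      chainCycle n k ^ n * (chainCycle n k)⁻¹ ^ n * chainCycle n k ^ k :=
  ext_maps fun p q => by
    rw [maps_chainCycle_pow_mul_inv_pow hk le_rfl, maps_idempotent_mul_chainCycle_pow hk]
    have hk' : p.val + k ≡ p.val [MOD k] := by simp [Nat.ModEq]
    constructor
    · rintro ⟨rfl, h⟩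
      exact ⟨h, h, hk'⟩
    · rintro ⟨h1, h2, h3⟩
      exact ⟨Fin.ext ((hk'.symm.trans h3).eq_of_mem_window h1 p.isLt h2 q.isLt), h1⟩

/-! ### Separation of the normal forms -/

/-- Here `u` is the point reached after `i` steps back; `u + j`, the farthest point visited, must
still lie on the chain. -/
theorem maps_chainCycle_normalForm (hk : 1 ≤ k) {i j l : ℕ} {p q : Fin (n + k)} (hp : p.val < n) :
    ((chainCycle n k)⁻¹ ^ i * chainCycle n k ^ j * (chainCycle n k)⁻¹ ^ l).Maps p q ↔
      ∃ u, p.val = u + i ∧ u + j < n ∧ q.val + l = u + j := by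
  simp only [maps_mul, maps_inv_pow, maps_chainCycle_pow hk]
  constructor
  · rintro ⟨v, ⟨u, h1 | h1, h2 | h2⟩, h3 | h3⟩ <;> first | omega | exact ⟨u.val, by omega⟩
  · rintro ⟨u, h1, h2, h3⟩
    exact ⟨⟨u + j, by omega⟩, ⟨⟨u, by omega⟩, Or.inl (by dsimp only; omega),
      Or.inl (by dsimp only; omega)⟩, Or.inl (by dsimp only; omega)⟩

/-- A normal form with `j < n` is determined by its action on the chain. -/
theorem chainCycle_normalForm_le (hk : 1 ≤ k) {i j l i' j' l' : ℕ} (hi : i ≤ j) (hl : l ≤ j)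
    (hj : j < n)
    (h : (chainCycle n k)⁻¹ ^ i * chainCycle n k ^ j * (chainCycle n k)⁻¹ ^ l =
      (chainCycle n k)⁻¹ ^ i' * chainCycle n k ^ j' * (chainCycle n k)⁻¹ ^ l') :
    i' ≤ i ∧ i + j' ≤ j + i' ∧ j + i' + l' = j' + i + l := by
  -- The test points are the first and last chain points of the domain, `u = 0` and `u = n - 1 - j`.
  -- The first bounds `i'` and fixes the displacement, the second bounds `j' - i'`.
  have h0 := (maps_chainCycle_normalForm (n := n) hk (i := i) (j := j) (l := l)
    (p := ⟨i, by omega⟩) (q := ⟨j - l, by omega⟩) (by dsimp only; omega)).2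
    ⟨0, by dsimp only; omega⟩
  have h1 := (maps_chainCycle_normalForm (n := n) hk (i := i) (j := j) (l := l)
    (p := ⟨i + (n - 1 - j), by omega⟩) (q := ⟨n - 1 - l, by omega⟩) (by dsimp only; omega)).2
    ⟨n - 1 - j, by dsimp only; omega⟩
  rw [h] at h0 h1
  obtain ⟨u, hu⟩ := (maps_chainCycle_normalForm hk (by dsimp only; omega)).1 h0
  obtain ⟨v, hv⟩ := (maps_chainCycle_normalForm hk (by dsimp only; omega)).1 h1
  dsimp only at hu hv
  omega

/-- The left side is defined at the chain point `i`, the right side only on the cycle. -/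
theorem chainCycle_normalForm_ne (hk : 1 ≤ k) {i j l r : ℕ} (hi : i ≤ j) (hl : l ≤ j)
    (hj : j < n) :
    (chainCycle n k)⁻¹ ^ i * chainCycle n k ^ j * (chainCycle n k)⁻¹ ^ l ≠
      chainCycle n k ^ n * (chainCycle n k)⁻¹ ^ n * chainCycle n k ^ r := by
  intro h
  have h0 := (maps_chainCycle_normalForm (n := n) hk (i := i) (j := j) (l := l)
    (p := ⟨i, by omega⟩) (q := ⟨j - l, by omega⟩) (by dsimp only; omega)).2
    ⟨0, by dsimp only; omega⟩
  rw [h, maps_idempotent_mul_chainCycle_pow hk] at h0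
  dsimp only at h0
  omega

theorem chainCycle_idempotent_mul_pow_inj (hk : 1 ≤ k) {r s : ℕ}
    (h : chainCycle n k ^ n * (chainCycle n k)⁻¹ ^ n * chainCycle n k ^ r =
      chainCycle n k ^ n * (chainCycle n k)⁻¹ ^ n * chainCycle n k ^ s) : r ≡ s [MOD k] := by
  obtain ⟨q, hq, hq'⟩ := exists_fin_modEq hk (show n ≤ n + r by omega)
  have h0 := (maps_idempotent_mul_chainCycle_pow hk (r := r) (p := ⟨n, by omega⟩) (q := q)).2
    ⟨le_rfl, hq, hq'⟩
  rw [h, maps_idempotent_mul_chainCycle_pow hk] at h0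
  exact Nat.ModEq.add_left_cancel' n (hq'.trans h0.2.2.symm)

/-- The representation of `S_{n,k}` by partial permutations. -/
def monogenicRep (n k : ℕ) (hk : 1 ≤ k) :
    MonogenicInverseMonoid n k →* SymmetricInverseMonoid (n + k) :=
  MonogenicInverseMonoid.lift (chainCycle n k) (chainCycle_chain hk) (chainCycle_cycle hk)

theorem monogenicRep_injective (hk : 1 ≤ k) : Function.Injective (monogenicRep n k hk) := by
  have hnf (a : MonogenicInverseMonoid n k) := exists_reduced_normalForm hk
    MonogenicInverseMonoid.gen_chain MonogenicInverseMonoid.gen_cycle (a := a)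
    (by rw [MonogenicInverseMonoid.closureSingleton_gen]; trivial)
  have hx : monogenicRep n k hk (MonogenicInverseMonoid.gen n k) = chainCycle n k :=
    MonogenicInverseMonoid.lift_gen
  have hx' : monogenicRep n k hk (MonogenicInverseMonoid.gen n k)⁻¹ = (chainCycle n k)⁻¹ :=
    MonogenicInverseMonoid.lift_gen_inv
  intro a b hab
  rcases hnf a with ⟨i, j, l, hi, hl, hj, rfl⟩ | ⟨r, rfl⟩ <;>
    rcases hnf b with ⟨i', j', l', hi', hl', hj', rfl⟩ | ⟨s, rfl⟩ <;>
    simp only [map_mul, map_pow, hx, hx'] at hab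
  -- The one-sided bounds, used in both directions, determine all three exponents.
  · have h1 := chainCycle_normalForm_le hk hi hl hj hab
    have h2 := chainCycle_normalForm_le hk hi' hl' hj' hab.symm
    obtain ⟨rfl, rfl, rfl⟩ : i = i' ∧ j = j' ∧ l = l' := by omega
    rfl
  · exact absurd hab (chainCycle_normalForm_ne hk hi hl hj)
  · exact absurd hab.symm (chainCycle_normalForm_ne hk hi' hl' hj')
  · exact pow_mul_inv_pow_mul_pow_congr MonogenicInverseMonoid.gen_cycle
      (chainCycle_idempotent_mul_pow_inj hk hab)

theorem nonempty_closureSingleton_chainCycle_mulEquiv (hk : 1 ≤ k) :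
    Nonempty (closureSingleton (chainCycle n k) ≃* MonogenicInverseMonoid n k) :=
  ⟨((MulEquiv.ofBijective (monogenicRep n k hk).mrangeRestrict
    ⟨fun _ _ h => monogenicRep_injective hk (congrArg Subtype.val h),
      (monogenicRep n k hk).mrangeRestrict_surjective⟩).trans
    (MulEquiv.submonoidCongr MonogenicInverseMonoid.mrange_lift)).symm⟩

/-! ### Displacements and the power law -/

/-- `f` moves the points of the chain and of the cycle by `s`, and is defined on the cycle. -/
structure HasShift (n k : ℕ) (f : SymmetricInverseMonoid (n + k)) (s : ℤ) : Prop where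
  chain : ∀ p q : Fin (n + k), p.val < n → f.Maps p q → q.val < n ∧ (q.val : ℤ) = p.val + s
  cycle : ∀ p q : Fin (n + k), n ≤ p.val →
    (f.Maps p q ↔ n ≤ q.val ∧ (p.val : ℤ) + s ≡ q.val [ZMOD k])

theorem hasShift_one : HasShift n k 1 0 where
  chain p q hp h := by
    rw [maps_one] at h
    subst h
    exact ⟨hp, by simp⟩
  cycle p q hp := by
    rw [maps_one, add_zero, Int.natCast_modEq_iff]
    constructor
    · rintro rfl
      exact ⟨hp, rfl⟩
    · rintro ⟨h1, h2⟩
      exact Fin.ext (h2.eq_of_mem_window hp p.isLt h1 q.isLt)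

theorem hasShift_chainCycle : HasShift n k (chainCycle n k) 1 where
  chain p q hp h := by
    rw [maps_chainCycle] at h
    omega
  cycle p q hp := by
    rw [maps_chainCycle, ← Int.natCast_modEq_iff]
    push_cast
    constructor
    · rintro (h | h)
      · omega
      · exact h.2
    · exact fun h => Or.inr ⟨hp, h⟩

theorem hasShift_chainCycle_inv : HasShift n k (chainCycle n k)⁻¹ (-1) where
  chain p q hp h := by
    rw [maps_inv, maps_chainCycle] at h
    omega
  cycle p q hp := by
    rw [maps_inv, maps_chainCycle, ← Int.natCast_modEq_iff]
    push_cast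
    constructor
    · rintro (h | ⟨h1, h2, h3⟩)
      · omega
      · refine ⟨h1, ?_⟩
        simpa using (h3.symm.add_right (-1))
    · rintro ⟨h1, h2⟩
      refine Or.inr ⟨h1, hp, ?_⟩
      simpa using (h2.symm.add_right 1)

theorem HasShift.mul (hk : 1 ≤ k) {f g : SymmetricInverseMonoid (n + k)} {s t : ℤ}
    (hf : HasShift n k f s) (hg : HasShift n k g t) : HasShift n k (f * g) (s + t) where
  chain p q hp h := by
    obtain ⟨r, h1, h2⟩ := maps_mul.1 h
    have h3 := hf.chain p r hp h1
    have h4 := hg.chain r q h3.1 h2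
    omega
  cycle p q hp := by
    rw [maps_mul, ← add_assoc]
    constructor
    · rintro ⟨r, h1, h2⟩
      obtain ⟨h3, h4⟩ := (hf.cycle p r hp).1 h1
      obtain ⟨h5, h6⟩ := (hg.cycle r q h3).1 h2
      exact ⟨h5, (h4.add_right t).trans h6⟩
    · rintro ⟨h1, h2⟩
      -- The shift `s` may be negative, so `p + s - n` is reduced mod `k` before passing to
      -- naturals; adding `n` lands on the cycle.
      obtain ⟨r, hr, hr'⟩ := exists_fin_modEq (n := n) hk
        (show n ≤ n + ((p.val + s - n) % k).toNat by omega)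
      have h3 : (p.val : ℤ) + s ≡ r.val [ZMOD k] := by
        have h4 := Int.natCast_modEq_iff.2 hr'
        have h5 : ((((p.val + s - n) % k).toNat : ℕ) : ℤ) = (p.val + s - n) % k :=
          Int.toNat_of_nonneg (Int.emod_nonneg _ (by omega))
        rw [Nat.cast_add, h5] at h4
        refine Int.ModEq.trans ?_ h4
        have h6 := (Int.mod_modEq ((p.val : ℤ) + s - n) k).symm.add_left (n : ℤ)
        simpa using h6
      exact ⟨r, (hf.cycle p r hp).2 ⟨hr, h3⟩,
        (hg.cycle r q hr).2 ⟨h1, (h3.symm.add_right t).trans h2⟩⟩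

theorem HasShift.pow (hk : 1 ≤ k) {f : SymmetricInverseMonoid (n + k)} {s : ℤ}
    (hf : HasShift n k f s) (m : ℕ) : HasShift n k (f ^ m) (m * s) := by
  induction m with
  | zero => simpa using hasShift_one
  | succ m ih =>
    rw [pow_succ]
    convert ih.mul hk hf using 1
    push_cast
    ring

theorem exists_hasShift (hk : 1 ≤ k) {f : SymmetricInverseMonoid (n + k)}
    (hf : f ∈ closureSingleton (chainCycle n k)) : ∃ s, HasShift n k f s := by
  unfold closureSingleton at hf
  induction hf using Submonoid.closure_induction with
  | mem f hf =>
    rcases hf with rfl | rfl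
    · exact ⟨_, hasShift_chainCycle⟩
    · exact ⟨_, hasShift_chainCycle_inv⟩
  | one => exact ⟨_, hasShift_one⟩
  | mul f g _ _ hf hg =>
    obtain ⟨s, hs⟩ := hf
    obtain ⟨t, ht⟩ := hg
    exact ⟨_, hs.mul hk ht⟩

/-- The total displacement `m * s` has size at least `n`, more than two chain points can differ by.
-/
theorem HasShift.not_maps_pow (hk : 1 ≤ k) {f : SymmetricInverseMonoid (n + k)} {s : ℤ}
    (hf : HasShift n k f s) (hs : s ≠ 0) {m : ℕ} (hm : n ≤ m) {p q : Fin (n + k)}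
    (hp : p.val < n) : ¬ (f ^ m).Maps p q := by
  intro h
  obtain ⟨h1, h2⟩ := (hf.pow hk m).chain p q hp h
  rcases lt_or_gt_of_ne hs with h3 | h3 <;> nlinarith

/-- With shift zero, `f` is a partial identity on the chain, hence idempotent there. -/
theorem HasShift.maps_pow_of_zero {f : SymmetricInverseMonoid (n + k)}
    (hf : HasShift n k f 0) {m : ℕ} (hm : 1 ≤ m) {p q : Fin (n + k)} (hp : p.val < n) :
    (f ^ m).Maps p q ↔ f.Maps p q := by
  obtain ⟨m, rfl⟩ := Nat.exists_eq_add_of_le' hm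
  clear hm
  induction m with
  | zero => rw [zero_add, pow_one]
  | succ m ih =>
    rw [pow_succ', maps_mul]
    have hfix : ∀ r, f.Maps p r → r = p := fun r hr => by
      have := hf.chain p r hp hr
      exact Fin.ext (by omega)
    constructor
    · rintro ⟨r, h1, h2⟩
      obtain rfl := hfix r h1
      exact ih.1 h2
    · intro h
      obtain rfl := hfix q h
      exact ⟨q, h, ih.2 h⟩

/-- The law `aⁿ = aⁿ⁺ᵏ` holds in the inverse monoid generated by `chainCycle n k`. -/
theorem pow_add_eq_pow_of_mem_closureSingleton_chainCycle (hk : 1 ≤ k)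
    {f : SymmetricInverseMonoid (n + k)} (hf : f ∈ closureSingleton (chainCycle n k)) :
    f ^ (n + k) = f ^ n := by
  obtain ⟨s, hs⟩ := exists_hasShift hk hf
  refine ext_maps fun p q => ?_
  rcases Nat.lt_or_ge p.val n with hp | hp
  · rcases eq_or_ne s 0 with rfl | hs0
    · rw [hs.maps_pow_of_zero (by omega) hp, hs.maps_pow_of_zero (by omega) hp]
    · exact iff_of_false (hs.not_maps_pow hk hs0 (by omega) hp)
        (hs.not_maps_pow hk hs0 le_rfl hp)
  · rw [(hs.pow hk _).cycle p q hp, (hs.pow hk _).cycle p q hp]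
    have h : (p.val : ℤ) + (n + k : ℕ) * s ≡ p.val + n * s [ZMOD k] := by
      refine Int.ModEq.add_left _ ?_
      push_cast
      rw [add_mul]
      simp [Int.ModEq]
    exact and_congr_right fun _ => ⟨h.symm.trans, h.trans⟩

/-! ### Recovering the parameters -/

/-- If `m < n`, the smaller power sends the first chain point to position `m`, which the larger
power cannot do. On the cycle, `l` further steps must be trivial. -/
theorem le_and_dvd_of_chainCycle_pow_eq (hk : 1 ≤ k) {m l : ℕ} (hl : 1 ≤ l)
    (h : chainCycle n k ^ (m + l) = chainCycle n k ^ m) : n ≤ m ∧ k ∣ l := by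
  constructor
  · by_contra! hmn
    have h0 := (maps_chainCycle_pow hk (m := m) (p := ⟨0, by omega⟩) (q := ⟨m, by omega⟩)).2
      (Or.inl ⟨hmn, by simp⟩)
    rw [← h, maps_chainCycle_pow hk] at h0
    dsimp only at h0
    omega
  · obtain ⟨q, hq, hq'⟩ := exists_fin_modEq hk (show n ≤ n + m by omega)
    have h0 := (maps_chainCycle_pow hk (m := m) (p := ⟨n, by omega⟩) (q := q)).2
      (Or.inr ⟨le_rfl, hq, hq'⟩)
    rw [← h, maps_chainCycle_pow hk] at h0
    rcases h0 with h0 | ⟨-, -, h0⟩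
    · omega
    · have h1 : n + m + l ≡ n + m + 0 [MOD k] := by
        rw [add_assoc]
        exact h0.trans hq'.symm
      exact (Nat.modEq_zero_iff_dvd).1 (Nat.ModEq.add_left_cancel' (n + m) h1)

theorem le_and_dvd_of_mulEquiv {m l : ℕ} (hk : 1 ≤ k) (hl : 1 ≤ l)
    (φ : MonogenicInverseMonoid n k ≃* MonogenicInverseMonoid m l) : n ≤ m ∧ k ∣ l := by
  obtain ⟨α⟩ := nonempty_closureSingleton_chainCycle_mulEquiv (n := n) hk
  obtain ⟨β⟩ := nonempty_closureSingleton_chainCycle_mulEquiv (n := m) hl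
  have ψ := (α.trans φ).trans β.symm
  have hx : chainCycle n k ∈ closureSingleton (chainCycle n k) :=
    Submonoid.subset_closure (Or.inl rfl)
  refine le_and_dvd_of_chainCycle_pow_eq hk hl ?_
  have h : (⟨_, hx⟩ : closureSingleton (chainCycle n k)) ^ (m + l) = ⟨_, hx⟩ ^ m := by
    -- The image of the generator is an unknown element of the target, but the power law there holds
    -- for every element.
    apply ψ.injective
    rw [map_pow, map_pow]
    exact Subtype.ext (pow_add_eq_pow_of_mem_closureSingleton_chainCycle hl (ψ ⟨_, hx⟩).2)
  exact congrArg Subtype.val h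

end ChainCycle

theorem mainTheorem3 :
    (∀ n k : ℕ, 1 ≤ k →
      Nonempty (InverseMonoid.closureSingleton (chainCycle n k) ≃* MonogenicInverseMonoid n k)) ∧
    (∀ n k m l : ℕ, 1 ≤ k → 1 ≤ l →
      (Nonempty (MonogenicInverseMonoid n k ≃* MonogenicInverseMonoid m l) ↔
        (n, k) = (m, l))) := by
  refine ⟨fun n k hk => nonempty_closureSingleton_chainCycle_mulEquiv hk,
    fun n k m l hk hl => ⟨?_, ?_⟩⟩
  · rintro ⟨φ⟩
    obtain ⟨h1, h2⟩ := le_and_dvd_of_mulEquiv hk hl φ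
    obtain ⟨h3, h4⟩ := le_and_dvd_of_mulEquiv hl hk φ.symm
    exact Prod.ext (le_antisymm h1 h3) (Nat.dvd_antisymm h2 h4)
  · rintro h
    obtain ⟨rfl, rfl⟩ := Prod.mk.inj h
    exact ⟨MulEquiv.refl _⟩
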